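/- A weight on $[0,\infty)$ is a function $w:[0,\infty)\to(0,\infty)$ that is non-decreasing, continuous, unbounded and satisfies $\log r=o(\log w(r))$ as $r\to\infty$. For an entire function $f$ and $r\ge 0$ put $M_\infty(f,r)=\max_{0\le\theta<2\pi}|f(re^{i\theta})|$. For a weight $w$, let $H_w^\infty(\mathbb C)$ be the space of entire functions $f$ with $$\|f\|_{H_w^\infty}=\sup_{0\le r<\infty}\frac{M_\infty(f,r)}{w(r)}<\infty,$$ and let $$\widetilde w(t)=\sup\{M_\infty(f,t): f \text{ entire},\ M_\infty(f,r)\le w(r)\text{ for all } r\ge 0\},\qquad t\ge 0,$$ be the associated weight of $w$. Let $J$ be the integration operator $Jf(z)=\int_0^z f(\zeta)\,d\zeta$, $z\in\mathbb C$, on entire functions. Let $w,u$ be weights on $[0,\infty)$. Then the following properties are equivalent: (i) there is a constant $C$ such that $\int_0^r\widetilde w(t)\,dt\le C\,u(r)$ for all $0\le r<\infty$; (ii) $J:H_w^\infty(\mathbb C)\to H_u^\infty(\mathbb C)$ is a bounded operator, that is, $J$ maps $H_w^\infty(\mathbb C)$ into $H_u^\infty(\mathbb C)$ and there is a finite constant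 $K$ with $\|Jf\|_{H_u^\infty}\le K\|f\|_{H_w^\infty}$ for all $f\in H_w^\infty(\mathbb C)$. -/

import Mathlib

open scoped ENNReal NNReal

namespace GrowthSpace

/-- A weight on `[0, ∞)`: a function `[0, ∞) → (0, ∞)` which is non-decreasing, continuous, unbounded,
and grows faster than every polynomial, that is, `log r = o(log (w r))` as `r → ∞`.
Only the values of `w` on `[0, ∞)` matter. -/
structure IsWeight (w : ℝ → ℝ) : Prop where
  pos : ∀ r, 0 ≤ r → 0 < w r
  mono : MonotoneOn w (Set.Ici 0)
  cont : ContinuousOn w (Set.Ici 0)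
  unbounded : ¬ BddAbove (w '' Set.Ici 0)
  log_isLittleO : Asymptotics.IsLittleO Filter.atTop Real.log (fun r => Real.log (w r))

/-- The maximum modulus `M_∞(f, r) = max_{0 ≤ θ < 2π} |f (r e^{iθ})|`. -/
noncomputable def maxModulus (f : ℂ → ℂ) (r : ℝ) : ℝ :=
  sSup ((fun θ : ℝ => ‖f (r * Complex.exp (θ * Complex.I))‖) '' Set.Ico 0 (2 * Real.pi))

/-- The growth norm `sup_{0 ≤ r < ∞} M_∞(f, r) / w r`, with values in `[0, ∞]`. -/
noncomputable def growthNorm (w : ℝ → ℝ) (f : ℂ → ℂ) : ℝ≥0∞ :=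
  ⨆ r ∈ Set.Ici (0 : ℝ), ENNReal.ofReal (maxModulus f r / w r)

/-- The growth space `H_w^∞(ℂ)`: the entire functions of finite growth norm. -/
def growthSpace (w : ℝ → ℝ) : Set (ℂ → ℂ) :=
  {f | Differentiable ℂ f ∧ growthNorm w f < ∞}

/-- The integration operator `J f (z) = ∫_0^z f(ζ) dζ`, where the integral is taken along the segment
`ζ = t z`, `0 ≤ t ≤ 1` (for entire `f` it does not depend on the path). -/
noncomputable def integrationOp (f : ℂ → ℂ) (z : ℂ) : ℂ :=
  ∫ t in (0 : ℝ)..1, f (t * z) * z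

/-- `T : H_w^∞(ℂ) → H_u^∞(ℂ)` is a bounded operator: `T` maps the first space into the second one, and
`‖T f‖ ≤ K ‖f‖` for a finite constant `K`. -/
def IsBoundedOperator (T : (ℂ → ℂ) → (ℂ → ℂ)) (w u : ℝ → ℝ) : Prop :=
  Set.MapsTo T (growthSpace w) (growthSpace u) ∧
    ∃ K : ℝ≥0, ∀ f ∈ growthSpace w, growthNorm u (T f) ≤ K * growthNorm w f

/-- The associated weight of `w`:
`t ↦ sup {M_∞(f, t) : f entire, M_∞(f, r) ≤ w r for all r ≥ 0}`. -/
noncomputable def assocWeight (w : ℝ → ℝ) (t : ℝ) : ℝ :=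
  sSup {x | ∃ f : ℂ → ℂ, Differentiable ℂ f ∧ (∀ r, 0 ≤ r → maxModulus f r ≤ w r) ∧
    x = maxModulus f t}

end GrowthSpace

namespace GrowthSpace

/-! ### The maximum modulus -/

/-! Dividing `f` by its norm `N` gives a competitor for the associated weight, so `M(f,t) ≤ N *
assocWeight w t`; integrating along rays gives (i) ⇒ (ii).

For (ii) ⇒ (i) it is enough to have one entire `g`, bounded by a multiple of `w`, with `g ≥ 0` and
`assocWeight w ≤ 24 g` on `[0,∞)` (`exists_entire_ge_assocWeight`): then `∫ assocWeight w ≤ 24 (J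
g)(r) ≤ 24 ‖J g‖ u(r)`.

To build `g`, take for each `n` the largest multiple `a n * r ^ n` below `w`, touching `w` at `x n`.
An entire function below `w` is at most `a n * r ^ n` on `‖z‖ = x n`. The maximum principle for `f /
z ^ n`, with Cauchy's estimates across wide gaps, bounds it by `24` times the two neighbouring
monomials between contact points (`norm_le_of_mem_Icc`). The sum of all these monomials may be far
larger than `w`, so indices `m k` are chosen greedily, each the first one separated from the
previous. Separation makes the selected terms decay geometrically (`summable_and_tsum_le`);
non-separation of `m k` and `m (k + 1) - 1` lets three monomials bound `f` on the whole gap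
(`norm_le_of_not_separated`). Then `g` is the sum of the selected monomials and their predecessors.
-/

lemma maxModulus_le {f : ℂ → ℂ} {r c : ℝ} (hr : 0 ≤ r) (h : ∀ z : ℂ, ‖z‖ = r → ‖f z‖ ≤ c) :
    maxModulus f r ≤ c := by
  refine csSup_le ((Set.nonempty_Ico.2 Real.two_pi_pos).image _) ?_
  rintro _ ⟨θ, -, rfl⟩
  exact h _ (by simp [Complex.norm_exp_ofReal_mul_I, abs_of_nonneg hr])

lemma norm_le_maxModulus {f : ℂ → ℂ} (hf : Continuous f) (z : ℂ) :
    ‖f z‖ ≤ maxModulus f ‖z‖ := by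
  have hbdd : BddAbove ((fun θ : ℝ => ‖f ((‖z‖ : ℝ) * Complex.exp (θ * Complex.I))‖) ''
      Set.Ico 0 (2 * Real.pi)) := by
    refine BddAbove.mono (Set.image_mono Set.Ico_subset_Icc_self) ?_
    exact (isCompact_Icc.image (by fun_prop)).bddAbove
  refine le_csSup hbdd ⟨toIcoMod Real.two_pi_pos 0 z.arg, ?_, ?_⟩
  · simpa using toIcoMod_mem_Ico Real.two_pi_pos 0 z.arg
  · have : Complex.exp ((toIcoMod Real.two_pi_pos 0 z.arg : ℝ) * Complex.I) =
        Complex.exp (z.arg * Complex.I) := by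
      rw [Complex.exp_eq_exp_iff_exists_int]
      refine ⟨-toIcoDiv Real.two_pi_pos 0 z.arg, ?_⟩
      rw [toIcoMod]
      push_cast [zsmul_eq_mul]
      ring
    simp only [this, Complex.norm_mul_exp_arg_mul_I]

/-- The maximum principle on a closed annulus `s ≤ ‖z‖ ≤ t`, applied to `f z / z ^ n`. -/
lemma norm_le_mul_pow_of_annulus {f : ℂ → ℂ} (hf : Differentiable ℂ f) {n : ℕ} {s t A : ℝ}
    (hs : 0 ≤ s) (hsn : s = 0 → n = 0)
    (h₁ : ∀ z : ℂ, ‖z‖ = s → ‖f z‖ ≤ A * s ^ n) (h₂ : ∀ z : ℂ, ‖z‖ = t → ‖f z‖ ≤ A * t ^ n)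
    {z : ℂ} (hsz : s ≤ ‖z‖) (hzt : ‖z‖ ≤ t) : ‖f z‖ ≤ A * ‖z‖ ^ n := by
  rcases hsz.eq_or_lt with hsz | hsz
  · rw [← hsz]; exact h₁ z hsz.symm
  rcases hzt.eq_or_lt with hzt | hzt
  · rw [hzt]; exact h₂ z hzt
  -- For `s = 0` the annulus is a disc; `hsn` forces `n = 0`, so the quotient has no pole at the
  -- origin.
  rcases hs.eq_or_lt with hs | hs
  · obtain rfl := hsn hs.symm
    simp only [pow_zero, mul_one] at *
    refine Complex.norm_le_of_forall_mem_frontier_norm_le (U := Metric.ball 0 t)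
      Metric.isBounded_ball hf.diffContOnCl (fun y hy => h₂ y ?_)
      (subset_closure (by simpa using hzt))
    simpa using Metric.frontier_ball_subset_sphere hy
  · set U : Set ℂ := {y | s < ‖y‖ ∧ ‖y‖ < t} with hU
    have hUo : IsOpen U :=
      (isOpen_lt continuous_const continuous_norm).inter (isOpen_lt continuous_norm continuous_const)
    have hcl : closure U ⊆ {y | s ≤ ‖y‖ ∧ ‖y‖ ≤ t} :=
      closure_minimal (fun y hy => ⟨hy.1.le, hy.2.le⟩)
        ((isClosed_le continuous_const continuous_norm).inter
          (isClosed_le continuous_norm continuous_const))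
    have hne : ∀ y ∈ closure U, y ≠ 0 := fun y hy h => by
      have := (hcl hy).1
      rw [h, norm_zero] at this
      linarith
    have key := Complex.norm_le_of_forall_mem_frontier_norm_le (f := fun y => f y / y ^ n) (C := A)
      (U := U) (Metric.isBounded_ball (x := (0 : ℂ)) (r := t) |>.subset
        fun y hy => by simpa using hy.2)
      (DifferentiableOn.diffContOnCl fun y hy =>
        ((hf y).fun_div (differentiableAt_id.pow n) (pow_ne_zero _ (hne y hy))).differentiableWithinAt)
      (fun y hy => by
        have hy' := hcl hy.1
        have hpos : 0 < ‖y‖ := norm_pos_iff.2 (hne y hy.1)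
        rw [norm_div, norm_pow, div_le_iff₀ (by positivity)]
        have hyU : ¬ (s < ‖y‖ ∧ ‖y‖ < t) := by
          have := hy.2
          rwa [hUo.interior_eq] at this
        rcases hy'.1.eq_or_lt with h | h
        · rw [← h]; exact h₁ y h.symm
        rcases hy'.2.eq_or_lt with h' | h'
        · rw [h']; exact h₂ y h'
        exact absurd ⟨h, h'⟩ hyU)
      (subset_closure ⟨hsz, hzt⟩)
    rwa [norm_div, norm_pow, div_le_iff₀ (pow_pos (hs.trans hsz) n)] at key

lemma norm_le_maxModulus_of_norm_le {f : ℂ → ℂ} (hf : Differentiable ℂ f) {z : ℂ} {r : ℝ}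
    (hz : ‖z‖ ≤ r) : ‖f z‖ ≤ maxModulus f r := by
  rcases hz.eq_or_lt with hz | hz
  · rw [← hz]
    exact norm_le_maxModulus hf.continuous z
  · refine Complex.norm_le_of_forall_mem_frontier_norm_le (U := Metric.ball 0 r)
      Metric.isBounded_ball hf.diffContOnCl (fun y hy => ?_) (subset_closure (by simpa using hz))
    have hy' : ‖y‖ = r := by simpa using Metric.frontier_ball_subset_sphere hy
    rw [← hy']
    exact norm_le_maxModulus hf.continuous y

lemma monotoneOn_maxModulus {f : ℂ → ℂ} (hf : Differentiable ℂ f) :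
    MonotoneOn (maxModulus f) (Set.Ici 0) := fun _ hr _ _ hrs =>
  maxModulus_le hr fun _ hz => norm_le_maxModulus_of_norm_le hf (hz.le.trans hrs)

lemma maxModulus_const_mul_le {f : ℂ → ℂ} (hf : Continuous f) {c : ℝ} (hc : 0 ≤ c) {r : ℝ}
    (hr : 0 ≤ r) : maxModulus (fun z => c * f z) r ≤ c * maxModulus f r :=
  maxModulus_le hr fun z hz => by
    rw [norm_mul, Complex.norm_real, Real.norm_of_nonneg hc, ← hz]
    exact mul_le_mul_of_nonneg_left (norm_le_maxModulus hf z) hc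

/-! ### The associated weight -/

lemma le_assocWeight {w : ℝ → ℝ} {f : ℂ → ℂ} (hf : Differentiable ℂ f)
    (hfw : ∀ r, 0 ≤ r → maxModulus f r ≤ w r) {t : ℝ} (ht : 0 ≤ t) :
    maxModulus f t ≤ assocWeight w t :=
  le_csSup ⟨w t, by rintro _ ⟨g, -, hg, rfl⟩; exact hg t ht⟩ ⟨f, hf, hfw, rfl⟩

lemma assocWeight_le {w : ℝ → ℝ} (hw : ∀ r, 0 ≤ r → 0 ≤ w r) {t c : ℝ}
    (h : ∀ f : ℂ → ℂ, Differentiable ℂ f → (∀ r, 0 ≤ r → maxModulus f r ≤ w r) →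
      maxModulus f t ≤ c) : assocWeight w t ≤ c := by
  refine csSup_le ⟨_, fun _ => 0, differentiable_const _, fun r hr => ?_, rfl⟩ ?_
  · exact maxModulus_le hr fun z _ => by simpa using hw r hr
  · rintro _ ⟨f, hf, hfw, rfl⟩
    exact h f hf hfw

lemma monotoneOn_assocWeight {w : ℝ → ℝ} (hw : ∀ r, 0 ≤ r → 0 ≤ w r) :
    MonotoneOn (assocWeight w) (Set.Ici 0) := fun _ hs _ ht hst =>
  assocWeight_le hw fun _ hf hfw =>
    (monotoneOn_maxModulus hf hs ht hst).trans (le_assocWeight hf hfw ht)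

lemma intervalIntegrable_assocWeight {w : ℝ → ℝ} (hw : ∀ r, 0 ≤ r → 0 ≤ w r) {r : ℝ}
    (hr : 0 ≤ r) : IntervalIntegrable (assocWeight w) MeasureTheory.volume 0 r := by
  refine MonotoneOn.intervalIntegrable ((monotoneOn_assocWeight hw).mono ?_)
  rw [Set.uIcc_of_le hr]
  exact fun t ht => ht.1

/-! ### The growth norm -/

lemma growthNorm_le_ofReal {w : ℝ → ℝ} (hw : ∀ r, 0 ≤ r → 0 < w r) {f : ℂ → ℂ} {c : ℝ}
    (h : ∀ r, 0 ≤ r → maxModulus f r ≤ c * w r) : growthNorm w f ≤ ENNReal.ofReal c :=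
  iSup₂_le fun r hr => ENNReal.ofReal_le_ofReal ((div_le_iff₀ (hw r hr)).2 (h r hr))

lemma maxModulus_le_growthNorm_mul {w : ℝ → ℝ} (hw : ∀ r, 0 ≤ r → 0 < w r) {f : ℂ → ℂ}
    (hf : growthNorm w f ≠ ∞) {r : ℝ} (hr : 0 ≤ r) :
    maxModulus f r ≤ (growthNorm w f).toReal * w r := by
  rw [← div_le_iff₀ (hw r hr)]
  refine (ENNReal.ofReal_le_iff_le_toReal hf).1 ?_
  exact le_iSup₂ (f := fun r (_ : r ∈ Set.Ici (0 : ℝ)) => ENNReal.ofReal (maxModulus f r / w r))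
    r hr

lemma maxModulus_le_growthNorm_mul_assocWeight {w : ℝ → ℝ} (hw : ∀ r, 0 ≤ r → 0 < w r)
    {f : ℂ → ℂ} (hf : f ∈ growthSpace w) {t : ℝ} (ht : 0 ≤ t) :
    maxModulus f t ≤ (growthNorm w f).toReal * assocWeight w t := by
  have hle : ∀ r, 0 ≤ r → maxModulus f r ≤ (growthNorm w f).toReal * w r := fun r hr =>
    maxModulus_le_growthNorm_mul hw hf.2.ne hr
  -- Norm zero excludes normalisation, but then `hle` already gives `maxModulus f t ≤ 0`.
  rcases (ENNReal.toReal_nonneg (a := growthNorm w f)).eq_or_lt with h0 | hpos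
  · simpa [← h0] using hle t ht
  set N := (growthNorm w f).toReal
  set g : ℂ → ℂ := fun z => (N⁻¹ : ℝ) * f z with hg
  have hgd : Differentiable ℂ g := hf.1.const_mul _
  have hgw : ∀ r, 0 ≤ r → maxModulus g r ≤ w r := fun r hr =>
    (maxModulus_const_mul_le hf.1.continuous (inv_nonneg.2 hpos.le) hr).trans
      ((inv_mul_le_iff₀ hpos).2 (hle r hr))
  have hfg : f = fun z => (N : ℂ) * g z := by
    ext z
    have : (N : ℂ) ≠ 0 := by exact_mod_cast hpos.ne'
    simp [hg, this]
  calc maxModulus f t = maxModulus (fun z => (N : ℂ) * g z) t := by rw [← hfg]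
    _ ≤ N * maxModulus g t := maxModulus_const_mul_le hgd.continuous hpos.le ht
    _ ≤ N * assocWeight w t := mul_le_mul_of_nonneg_left (le_assocWeight hgd hgw ht) hpos.le

/-! ### The integration operator -/

lemma differentiable_integrationOp {f : ℂ → ℂ} (hf : Differentiable ℂ f) :
    Differentiable ℂ (integrationOp f) := by
  obtain ⟨F, hF⟩ := hf.isExactOn_univ.with_val_at 0 0
  have hF' : ∀ z, HasDerivAt F (f z) z := fun z => hF.2 z (Set.mem_univ z)
  have : integrationOp f = fun z => F z - F 0 := by
    ext z
    have hd : ∀ t : ℝ, HasDerivAt (fun t : ℝ => F (t * z)) (f (t * z) * z) t := fun t => by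
      have h1 : HasDerivAt (fun s : ℂ => s * z) z (t : ℂ) := by
        simpa using (hasDerivAt_id (t : ℂ)).mul_const z
      exact ((hF' (t * z)).comp (t : ℂ) h1).comp_ofReal
    have hc : Continuous fun t : ℝ => f (t * z) * z :=
      (hf.continuous.comp (by fun_prop)).mul continuous_const
    have := intervalIntegral.integral_eq_sub_of_hasDerivAt (a := 0) (b := 1) (fun t _ => hd t)
      (hc.intervalIntegrable _ _)
    simpa [integrationOp] using this
  rw [this]
  exact fun z => (hF' z).differentiableAt.sub_const _

lemma maxModulus_integrationOp_le {f : ℂ → ℂ} (hf : Continuous f) {v : ℝ → ℝ} {r : ℝ}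
    (hr : 0 ≤ r) (hv : IntervalIntegrable v MeasureTheory.volume 0 r)
    (hfv : ∀ t, 0 ≤ t → maxModulus f t ≤ v t) :
    maxModulus (integrationOp f) r ≤ ∫ t in (0 : ℝ)..r, v t := by
  refine maxModulus_le hr fun z hz => ?_
  have hsub : (∫ t in (0 : ℝ)..1, v (t * r) * r) = ∫ t in (0 : ℝ)..r, v t := by
    rw [intervalIntegral.integral_mul_const, mul_comm, ← smul_eq_mul,
      intervalIntegral.smul_integral_comp_mul_right, zero_mul, one_mul]
  rw [← hsub]
  refine intervalIntegral.norm_integral_le_of_norm_le zero_le_one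
    (Filter.Eventually.of_forall fun t ht => ?_) ?_
  · have h := (norm_le_maxModulus hf (t * z)).trans (hfv _ (norm_nonneg _))
    rw [norm_mul, Complex.norm_real, Real.norm_of_nonneg ht.1.le, hz] at h
    rw [norm_mul, hz]
    exact mul_le_mul_of_nonneg_right h hr
  · rcases hr.eq_or_lt with rfl | hr
    · simp
    · have := hv.comp_mul_right (c := r)
      simp only [zero_div, div_self hr.ne'] at this
      exact this.mul_const r

/-- For functions which are real on `[0, ∞)` the operator is the usual integral there. -/
lemma integrationOp_ofReal {f : ℂ → ℂ} {g : ℝ → ℝ} {r : ℝ} (hr : 0 ≤ r)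
    (hfg : ∀ t : ℝ, 0 ≤ t → f t = g t) :
    integrationOp f r = ((∫ t in (0 : ℝ)..r, g t : ℝ) : ℂ) := by
  have h1 : integrationOp f r = ∫ t in (0 : ℝ)..1, ((g (t * r) * r : ℝ) : ℂ) := by
    refine intervalIntegral.integral_congr fun t ht => ?_
    rw [Set.uIcc_of_le zero_le_one] at ht
    have := hfg (t * r) (mul_nonneg ht.1 hr)
    push_cast at this ⊢
    rw [this]
  rw [h1, intervalIntegral.integral_ofReal, intervalIntegral.integral_mul_const, mul_comm,
    ← smul_eq_mul, intervalIntegral.smul_integral_comp_mul_right, zero_mul, one_mul]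

/-- An integral estimate for the associated weight implies boundedness of integration. -/
theorem isBoundedOperator_of_integral_assocWeight_le {w u : ℝ → ℝ} (hw : ∀ r, 0 ≤ r → 0 < w r)
    (hu : ∀ r, 0 ≤ r → 0 < u r) {C : ℝ}
    (hC : ∀ r : ℝ, 0 ≤ r → (∫ t in (0 : ℝ)..r, assocWeight w t) ≤ C * u r) :
    IsBoundedOperator integrationOp w u := by
  have hw' : ∀ r, 0 ≤ r → 0 ≤ w r := fun r hr => (hw r hr).le
  have key : ∀ f ∈ growthSpace w,
      growthNorm u (integrationOp f) ≤ (C.toNNReal : ℝ≥0∞) * growthNorm w f := by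
    intro f hf
    have h : growthNorm u (integrationOp f) ≤
        ENNReal.ofReal (C * (growthNorm w f).toReal) := by
      refine growthNorm_le_ofReal hu fun r hr => ?_
      calc maxModulus (integrationOp f) r
          ≤ ∫ t in (0 : ℝ)..r, (growthNorm w f).toReal * assocWeight w t :=
            maxModulus_integrationOp_le hf.1.continuous hr
              ((intervalIntegrable_assocWeight hw' hr).const_mul _)
              fun t ht => maxModulus_le_growthNorm_mul_assocWeight hw hf ht
        _ = (growthNorm w f).toReal * ∫ t in (0 : ℝ)..r, assocWeight w t :=
            intervalIntegral.integral_const_mul _ _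
        _ ≤ (growthNorm w f).toReal * (C * u r) :=
            mul_le_mul_of_nonneg_left (hC r hr) ENNReal.toReal_nonneg
        _ = _ := by ring
    rwa [ENNReal.ofReal_mul' ENNReal.toReal_nonneg, ENNReal.ofReal_toReal hf.2.ne] at h
  exact ⟨fun f hf => ⟨differentiable_integrationOp hf.1,
    (key f hf).trans_lt (ENNReal.mul_lt_top ENNReal.coe_lt_top hf.2)⟩, _, key⟩

/-! ### Elementary inequalities -/

/-- Multiplying by `(r / s) ^ j` preserves the inequality at `s`, and the higher power on the right
gains at least that much. -/
lemma mul_pow_le_mul_pow_of_le {A B s r : ℝ} {j n : ℕ} (hB : 0 ≤ B) (hjn : j ≤ n) (hs : 0 < s)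
    (hsr : s ≤ r) (h : A * s ^ j ≤ B * s ^ n) : A * r ^ j ≤ B * r ^ n := by
  obtain ⟨d, rfl⟩ := Nat.exists_eq_add_of_le hjn
  rw [pow_add, mul_comm (s ^ j), ← mul_assoc] at h
  have h' := (le_of_mul_le_mul_right h (pow_pos hs j)).trans
    (mul_le_mul_of_nonneg_left (pow_le_pow_left₀ hs.le hsr d) hB)
  rw [pow_add, mul_comm (r ^ j), ← mul_assoc]
  exact mul_le_mul_of_nonneg_right h' (pow_nonneg (hs.le.trans hsr) j)

lemma mul_pow_le_mul_pow_of_ge {A B s r : ℝ} {j n : ℕ} (hA : 0 ≤ A) (hnj : n ≤ j) (hr : 0 ≤ r)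
    (hrs : r ≤ s) (h : A * s ^ j ≤ B * s ^ n) : A * r ^ j ≤ B * r ^ n := by
  rcases hrs.eq_or_lt with rfl | hrs
  · exact h
  obtain ⟨d, rfl⟩ := Nat.exists_eq_add_of_le hnj
  rw [pow_add, mul_comm (s ^ n), ← mul_assoc] at h
  have h' := (mul_le_mul_of_nonneg_left (pow_le_pow_left₀ hr hrs.le d) hA).trans
    (le_of_mul_le_mul_right h (pow_pos (hr.trans_lt hrs) n))
  rw [pow_add, mul_comm (r ^ n), ← mul_assoc]
  exact mul_le_mul_of_nonneg_right h' (pow_nonneg hr n)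

/-- A sequence which decays geometrically in both directions away from the index `k` is summable. -/
lemma summable_and_tsum_le_of_geometric {g : ℕ → ℝ} {c : ℝ} {k : ℕ} (h0 : ∀ j, 0 ≤ g j)
    (h₁ : ∀ i j, j + i = k → g j ≤ c * (1 / 2) ^ i) (h₂ : ∀ i, g (i + k) ≤ c * (1 / 2) ^ i) :
    Summable g ∧ ∑' j, g j ≤ 4 * c := by
  have hc : 0 ≤ c := by simpa using (h0 k).trans (h₁ 0 k rfl)
  have hgeo := hasSum_geometric_two.mul_left c
  have hs' : Summable fun i => g (i + k) :=
    Summable.of_nonneg_of_le (fun i => h0 _) h₂ hgeo.summable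
  have hs : Summable g := (summable_nat_add_iff k).1 hs'
  refine ⟨hs, ?_⟩
  rw [← hs.sum_add_tsum_nat_add k]
  have e1 : ∑' i, g (i + k) ≤ c * 2 := hs'.tsum_le_of_sum_le fun s =>
    (Finset.sum_le_sum fun i _ => h₂ i).trans
      (sum_le_hasSum s (fun i _ => by positivity) hgeo)
  have e2 : ∑ j ∈ Finset.range k, g j ≤ c * 2 := by
    rw [← Finset.sum_range_reflect]
    refine (Finset.sum_le_sum (g := fun i => c * (1 / 2 : ℝ) ^ i) fun i hi => ?_).trans
      (sum_le_hasSum _ (fun i _ => by positivity) hgeo)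
    have hi := Finset.mem_range.1 hi
    refine (h₁ (i + 1) (k - 1 - i) (by omega)).trans ?_
    exact mul_le_mul_of_nonneg_left
      (pow_le_pow_of_le_one (by norm_num) (by norm_num) (Nat.le_succ i)) hc
  linarith

/-! ### Contact points of a weight with monomials -/

/-- `a n * r ^ n` is the largest multiple of `r ^ n` below `w`, and it touches `w` at `x n`. -/
structure IsContactSeq (w : ℝ → ℝ) (a x : ℕ → ℝ) : Prop where
  pos : ∀ n, 0 < a n
  nonneg : ∀ n, 0 ≤ x n
  zero : x 0 = 0
  le : ∀ n r, 0 ≤ r → a n * r ^ n ≤ w r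
  eq : ∀ n, a n * x n ^ n = w (x n)

namespace IsWeight

variable {w : ℝ → ℝ}

lemma eventually_pow_le (hw : IsWeight w) (n : ℕ) : ∀ᶠ r in Filter.atTop, r ^ n ≤ w r := by
  have hone : ∀ᶠ r in Filter.atTop, 1 ≤ w r := by
    obtain ⟨_, ⟨s, hs, rfl⟩, h1⟩ := not_bddAbove_iff.1 hw.unbounded 1
    filter_upwards [Filter.eventually_ge_atTop s] with r hr
    exact h1.le.trans (hw.mono hs (Set.mem_Ici.2 (le_trans hs hr)) hr)
  have hlog := hw.log_isLittleO.def (c := 1 / (n + 1)) (by positivity)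
  filter_upwards [hone, hlog, Filter.eventually_ge_atTop 1] with r h1 h2 hr
  rw [Real.norm_of_nonneg (Real.log_nonneg hr), Real.norm_of_nonneg (Real.log_nonneg h1),
    div_mul_eq_mul_div, one_mul, le_div_iff₀ (by positivity)] at h2
  rw [← Real.log_le_log_iff (by positivity) (by positivity), Real.log_pow]
  nlinarith [Real.log_nonneg hr]

/-- `s` maximises `r ^ n / w r`. For `n > 0` a maximum exists because `w` eventually exceeds `r ^ (n
+ 1)`, so the quotient falls below its value at `1`. For `n = 0` monotonicity allows `s = 0`. -/
lemma exists_contact (hw : IsWeight w) (n : ℕ) :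
    ∃ s, 0 ≤ s ∧ (n = 0 → s = 0) ∧ ∀ r, 0 ≤ r → w s * r ^ n ≤ w r * s ^ n := by
  rcases Nat.eq_zero_or_pos n with rfl | hn
  · exact ⟨0, le_rfl, fun _ => rfl, fun r hr => by simpa using hw.mono Set.self_mem_Ici hr hr⟩
  have hcont : ContinuousOn (fun r => r ^ n / w r) (Set.Ici 0) :=
    (continuousOn_pow n).div hw.cont fun r hr => (hw.pos r hr).ne'
  have hev : ∀ᶠ r in Filter.cocompact ℝ ⊓ Filter.principal (Set.Ici 0),
      r ^ n / w r ≤ 1 ^ n / w 1 := by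
    have hle : Filter.cocompact ℝ ⊓ Filter.principal (Set.Ici 0) ≤ Filter.atTop := by
      rw [cocompact_eq_atBot_atTop, inf_sup_right]
      refine sup_le ?_ inf_le_left
      rw [(Filter.disjoint_principal_right.2 _ : Disjoint _ _).eq_bot]
      · exact bot_le
      · filter_upwards [Filter.eventually_lt_atBot (0 : ℝ)] with r hr
        simpa using hr
    refine hle ?_
    filter_upwards [hw.eventually_pow_le (n + 1), Filter.eventually_ge_atTop (w 1),
      Filter.eventually_ge_atTop 1] with r h1 h2 h3
    rw [div_le_div_iff₀ (hw.pos r (by linarith)) (hw.pos 1 zero_le_one), one_pow, one_mul]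
    refine le_trans ?_ h1
    rw [pow_succ]
    exact mul_le_mul_of_nonneg_left h2 (by positivity)
  obtain ⟨s, hs, hmax⟩ := hcont.exists_isMaxOn' isClosed_Ici (Set.mem_Ici.2 zero_le_one) hev
  refine ⟨s, hs, fun h => absurd h hn.ne', fun r hr => ?_⟩
  have := isMaxOn_iff.1 hmax r hr
  rw [div_le_div_iff₀ (hw.pos r hr) (hw.pos s hs)] at this
  linarith

lemma exists_isContactSeq (hw : IsWeight w) : ∃ a x, IsContactSeq w a x := by
  choose x hx0 hx1 hx2 using hw.exists_contact
  have hxn : ∀ n, 0 < x n ^ n := fun n => by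
    rcases (hx0 n).eq_or_lt with h | h
    · have := hx2 n 1 zero_le_one
      rcases Nat.eq_zero_or_pos n with rfl | hn
      · simp
      · rw [← h, zero_pow hn.ne', one_pow] at this
        linarith [hw.pos 0 le_rfl]
    · positivity
  refine ⟨fun n => w (x n) / x n ^ n, x, fun n => div_pos (hw.pos _ (hx0 n)) (hxn n), hx0,
    hx1 0 rfl, fun n r hr => ?_, fun n => div_mul_cancel₀ _ (hxn n).ne'⟩
  rw [div_mul_eq_mul_div, div_le_iff₀ (hxn n)]
  exact hx2 n r hr

end IsWeight

namespace IsContactSeq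

variable {w : ℝ → ℝ} {a x : ℕ → ℝ}

lemma eq_zero_of_x_eq_zero (h : IsContactSeq w a x) (hw : IsWeight w) {n : ℕ} (hn : x n = 0) :
    n = 0 := by
  by_contra h0
  have := h.eq n
  rw [hn, zero_pow h0, mul_zero] at this
  exact (hw.pos 0 le_rfl).ne this

lemma x_pos (h : IsContactSeq w a x) (hw : IsWeight w) {n : ℕ} (hn : n ≠ 0) : 0 < x n :=
  (h.nonneg n).lt_of_ne' fun h0 => hn (h.eq_zero_of_x_eq_zero hw h0)

lemma term_nonneg (h : IsContactSeq w a x) {r : ℝ} (hr : 0 ≤ r) (n : ℕ) : 0 ≤ a n * r ^ n :=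
  mul_nonneg (h.pos n).le (pow_nonneg hr n)

/-- Source of the dominance and monotonicity statements below: no monomial exceeds `w`, and the
`n`-th one equals `w` at `x n`. -/
lemma le_at_contact (h : IsContactSeq w a x) (j n : ℕ) : a j * x n ^ j ≤ a n * x n ^ n :=
  (h.le j _ (h.nonneg n)).trans (h.eq n).ge

lemma term_le_of_le (h : IsContactSeq w a x) (hw : IsWeight w) {j n : ℕ} (hjn : j ≤ n) {r : ℝ}
    (hr : x n ≤ r) : a j * r ^ j ≤ a n * r ^ n := by
  rcases Nat.eq_zero_or_pos n with rfl | hn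
  · rw [Nat.le_zero.1 hjn]
  · exact mul_pow_le_mul_pow_of_le (h.pos n).le hjn (h.x_pos hw hn.ne') hr (h.le_at_contact j n)

lemma term_le_of_ge (h : IsContactSeq w a x) {j n : ℕ} (hnj : n ≤ j) {r : ℝ} (hr0 : 0 ≤ r)
    (hr : r ≤ x n) : a j * r ^ j ≤ a n * r ^ n :=
  mul_pow_le_mul_pow_of_ge (h.pos j).le hnj hr0 hr (h.le_at_contact j n)

lemma coeff_succ_mul_le (h : IsContactSeq w a x) (n : ℕ) : a (n + 1) * x n ≤ a n := by
  rcases (h.nonneg n).eq_or_lt with h0 | h0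
  · rw [← h0, mul_zero]
    exact (h.pos n).le
  · have := h.le_at_contact (n + 1) n
    rw [pow_succ', ← mul_assoc] at this
    exact le_of_mul_le_mul_right this (by positivity)

lemma coeff_le_succ_mul (h : IsContactSeq w a x) (hw : IsWeight w) (n : ℕ) :
    a n ≤ a (n + 1) * x (n + 1) := by
  have := h.le_at_contact n (n + 1)
  rw [pow_succ', ← mul_assoc] at this
  exact le_of_mul_le_mul_right this (pow_pos (h.x_pos hw n.succ_ne_zero) n)

lemma monotone_x (h : IsContactSeq w a x) (hw : IsWeight w) : Monotone x :=
  monotone_nat_of_le_succ fun n =>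
    le_of_mul_le_mul_left ((h.coeff_succ_mul_le n).trans (h.coeff_le_succ_mul hw n))
      (h.pos (n + 1))

lemma tendsto_term (h : IsContactSeq w a x) {r : ℝ} (hr : 0 ≤ r) :
    Filter.Tendsto (fun n => a n * r ^ n) Filter.atTop (nhds 0) := by
  have hr1 : 0 < r + 1 := by linarith
  have hlim : Filter.Tendsto (fun n : ℕ => w (r + 1) * (r / (r + 1)) ^ n) Filter.atTop (nhds 0) := by
    simpa using (tendsto_pow_atTop_nhds_zero_of_lt_one (by positivity)
      ((div_lt_one hr1).2 (lt_add_one r))).const_mul (w (r + 1))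
  refine squeeze_zero (h.term_nonneg hr) (fun n => ?_) hlim
  rw [div_pow, ← mul_div_assoc, le_div_iff₀ (by positivity)]
  have := mul_le_mul_of_nonneg_right (h.le n _ hr1.le) (pow_nonneg hr n)
  linarith

/-- If `x n < R`, then `w 0 ≤ w (x n) = a n * x n ^ n ≤ a n * max R 0 ^ n`, and the right side tends
to `0`. -/
lemma tendsto_x (h : IsContactSeq w a x) (hw : IsWeight w) :
    Filter.Tendsto x Filter.atTop Filter.atTop := by
  refine Filter.tendsto_atTop.2 fun R => ?_
  filter_upwards [(h.tendsto_term (le_max_right R 0)).eventually_lt_const (hw.pos 0 le_rfl)]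
    with n hn
  by_contra! hlt
  have h1 : w 0 ≤ w (x n) := hw.mono Set.self_mem_Ici (h.nonneg n) (h.nonneg n)
  have h2 : a n * x n ^ n ≤ a n * max R 0 ^ n := mul_le_mul_of_nonneg_left
    (pow_le_pow_left₀ (h.nonneg n) (hlt.le.trans (le_max_left _ _)) n) (h.pos n).le
  linarith [h.eq n]

/-! ### Estimates of entire functions below the weight -/

lemma norm_le_of_norm_eq_x (h : IsContactSeq w a x) {f : ℂ → ℂ} (hf : Differentiable ℂ f)
    (hfw : ∀ r, 0 ≤ r → maxModulus f r ≤ w r) {n : ℕ} {z : ℂ} (hz : ‖z‖ = x n) :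
    ‖f z‖ ≤ a n * x n ^ n := by
  rw [h.eq, ← hz]
  exact (norm_le_maxModulus hf.continuous z).trans (hfw _ (norm_nonneg z))

/-- Cauchy's estimate on the circle of radius `x n`, where the bound `w (x n)` is exactly `a n * x n
^ n`. -/
lemma norm_taylorCoeff_le (h : IsContactSeq w a x) (hw : IsWeight w) {f : ℂ → ℂ}
    (hf : Differentiable ℂ f) (hfw : ∀ r, 0 ≤ r → maxModulus f r ≤ w r) (n : ℕ) :
    ‖iteratedDeriv n f 0‖ ≤ n.factorial * a n := by
  rcases Nat.eq_zero_or_pos n with rfl | hn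
  · simpa [h.zero] using h.norm_le_of_norm_eq_x hf hfw (n := 0) (z := 0) (by simp [h.zero])
  · have hx := h.x_pos hw hn.ne'
    have := Complex.norm_iteratedDeriv_le_of_forall_mem_sphere_norm_le n hx
      (c := 0) (C := a n * x n ^ n) hf.diffContOnCl
      fun z hz => h.norm_le_of_norm_eq_x hf hfw (by simpa using hz)
    rwa [← mul_assoc, mul_div_cancel_right₀ _ (pow_pos hx n).ne'] at this

/-- Far from the two neighbouring contact points the power series is controlled by two terms. -/
lemma norm_le_of_far (h : IsContactSeq w a x) (hw : IsWeight w) {f : ℂ → ℂ}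
    (hf : Differentiable ℂ f) (hfw : ∀ r, 0 ≤ r → maxModulus f r ≤ w r) {p : ℕ} {z : ℂ}
    (h₁ : 2 * x p ≤ ‖z‖) (h₂ : 2 * ‖z‖ ≤ x (p + 1)) :
    ‖f z‖ ≤ 8 * (a p * ‖z‖ ^ p + a (p + 1) * ‖z‖ ^ (p + 1)) := by
  have hz := norm_nonneg z
  set r := ‖z‖ with hr
  have hP := h.term_nonneg hz p
  have hQ := h.term_nonneg hz (p + 1)
  -- Dominance is used at `r / 2 ≥ x p` for lower indices and at `2 * r ≤ x (p + 1)` for higher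
  -- ones; each step of the index then gains a factor `1 / 2`. The `2` in `c` is there because the
  -- decay above starts at `p + 1` rather than at the centre `p`.
  have hgeo := summable_and_tsum_le_of_geometric (g := fun j => a j * r ^ j) (k := p)
    (c := 2 * (a p * r ^ p + a (p + 1) * r ^ (p + 1))) (h.term_nonneg hz)
    (fun i j hij => by
      have e := h.term_le_of_le hw (show j ≤ p by omega) (show x p ≤ r / 2 by linarith)
      have e2 : a j * r ^ j ≤ a p * r ^ p * (1 / 2) ^ i := by
        rw [div_pow, div_pow, ← mul_div_assoc, ← mul_div_assoc, div_le_div_iff₀ (by positivity)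
          (by positivity), ← hij, pow_add 2 j i] at e
        rw [one_div, inv_pow, ← div_eq_mul_inv, le_div_iff₀ (by positivity), ← hij]
        have h2 : (0 : ℝ) < 2 ^ j := by positivity
        refine le_of_mul_le_mul_right ?_ h2
        calc _ = a j * r ^ j * (2 ^ j * 2 ^ i) := by ring
          _ ≤ _ := e
      refine e2.trans (mul_le_mul_of_nonneg_right (by linarith) (by positivity)))
    (fun i => by
      rcases i with _ | i
      · simp only [zero_add, pow_zero, mul_one]
        linarith
      have e := h.term_le_of_ge (show p + 1 ≤ i + 1 + p by omega)
        (show 0 ≤ 2 * r by linarith) h₂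
      have e2 : a (i + 1 + p) * r ^ (i + 1 + p) ≤ 2 * (a (p + 1) * r ^ (p + 1)) * (1 / 2) ^ (i + 1) := by
        rw [one_div, inv_pow, ← div_eq_mul_inv, le_div_iff₀ (by positivity)]
        have h2 : (0 : ℝ) < 2 ^ p := by positivity
        refine le_of_mul_le_mul_right ?_ h2
        calc _ = a (i + 1 + p) * (2 * r) ^ (i + 1 + p) := by rw [mul_pow]; ring
          _ ≤ a (p + 1) * (2 * r) ^ (p + 1) := e
          _ = _ := by rw [mul_pow]; ring
      refine e2.trans (mul_le_mul_of_nonneg_right (by linarith) (by positivity)))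
  have hsum := Complex.hasSum_taylorSeries_of_entire hf 0 z
  have := hsum.norm_le_of_bounded hgeo.1.hasSum fun n => by
    have hn : (0 : ℝ) < n.factorial := by positivity
    have hc := h.norm_taylorCoeff_le hw hf hfw n
    rw [sub_zero, smul_eq_mul, smul_eq_mul, norm_mul, norm_mul, norm_inv, norm_pow,
      Complex.norm_natCast, inv_mul_le_iff₀ hn]
    calc r ^ n * ‖iteratedDeriv n f 0‖ ≤ r ^ n * (n.factorial * a n) :=
          mul_le_mul_of_nonneg_left hc (by positivity)
      _ = _ := by ring
  linarith [hgeo.2]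

/-- Between neighbouring contact points an entire function below the weight is controlled by the two
corresponding monomials. -/
lemma norm_le_of_mem_Icc (h : IsContactSeq w a x) (hw : IsWeight w) {f : ℂ → ℂ}
    (hf : Differentiable ℂ f) (hfw : ∀ r, 0 ≤ r → maxModulus f r ≤ w r) {p : ℕ} {z : ℂ}
    (h₁ : x p ≤ ‖z‖) (h₂ : ‖z‖ ≤ x (p + 1)) :
    ‖f z‖ ≤ 24 * (a p * ‖z‖ ^ p + a (p + 1) * ‖z‖ ^ (p + 1)) := by
  have hP := h.term_nonneg (norm_nonneg z) p
  have hQ := h.term_nonneg (norm_nonneg z) (p + 1)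
  have hxp := h.nonneg p
  have hxs := h.x_pos hw p.succ_ne_zero
  have hc1 := h.coeff_succ_mul_le p
  have hc2 := h.coeff_le_succ_mul hw p
  -- In a narrow gap a single maximum principle loses at most a factor `4`. A wide gap is cut at `2
  -- * x p` and `x (p + 1) / 2`: on these circles one of the two monomials is at most twice the
  -- other, so the bound `8` for the sum becomes `24` for one monomial, and the maximum principle
  -- covers the two outer annuli.
  rcases lt_or_ge (x (p + 1)) (4 * x p) with hnear | hfar
  · have hx0 : 0 < x p := by linarith
    have key := norm_le_mul_pow_of_annulus hf (n := p + 1) (A := a p / x p) hxp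
      (fun h0 => absurd h0 hx0.ne')
      (fun y hy => (h.norm_le_of_norm_eq_x hf hfw hy).trans_eq (by field_simp; ring))
      (fun y hy => (h.norm_le_of_norm_eq_x hf hfw hy).trans
        (mul_le_mul_of_nonneg_right ((le_div_iff₀ hx0).2 hc1) (by positivity))) h₁ h₂
    have : a p / x p * ‖z‖ ^ (p + 1) ≤ 4 * (a p * ‖z‖ ^ p) := by
      rw [div_mul_eq_mul_div, div_le_iff₀ hx0, pow_succ]
      have := mul_le_mul_of_nonneg_left (h₂.trans hnear.le) hP
      linarith
    linarith
  rcases le_total ‖z‖ (2 * x p) with hz | hz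
  · have key := norm_le_mul_pow_of_annulus hf (n := p) (A := 24 * a p) hxp
      (h.eq_zero_of_x_eq_zero hw)
      (fun y hy => (h.norm_le_of_norm_eq_x hf hfw hy).trans
        (by linarith [h.term_nonneg hxp p]))
      (fun y hy => (h.norm_le_of_far hw hf hfw hy.ge (by rw [hy]; linarith)).trans (by
        rw [hy, pow_succ]
        have h2 : 0 ≤ (2 * x p) ^ p := by positivity
        have := mul_le_mul_of_nonneg_right hc1 h2
        linarith)) h₁ hz
    linarith
  rcases le_total (2 * ‖z‖) (x (p + 1)) with hz' | hz'
  · have := h.norm_le_of_far hw hf hfw hz hz'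
    linarith
  · have key := norm_le_mul_pow_of_annulus hf (n := p + 1) (A := 24 * a (p + 1))
      (s := x (p + 1) / 2) (t := x (p + 1)) (by linarith)
      (fun h0 => by linarith)
      (fun y hy => (h.norm_le_of_far hw hf hfw (p := p) (by rw [hy]; linarith)
        (by rw [hy]; linarith)).trans (by
        rw [hy, pow_succ]
        have h2 : 0 ≤ (x (p + 1) / 2) ^ p := by positivity
        have := mul_le_mul_of_nonneg_right hc2 h2
        linarith))
      (fun y hy => (h.norm_le_of_norm_eq_x hf hfw hy).trans
        (by linarith [h.term_nonneg hxs.le (p + 1)])) (by linarith) h₂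
    linarith

end IsContactSeq

/-! ### Selection of well separated monomials -/

/-- The monomials with indices `n < m` are separated: each is at most half of the other one at the
contact point of the latter. -/
def Separated (a x : ℕ → ℝ) (n m : ℕ) : Prop :=
  n < m ∧ 2 * a n * x m ^ n ≤ a m * x m ^ m ∧ 2 * a m * x n ^ m ≤ a n * x n ^ n

namespace IsContactSeq

variable {w : ℝ → ℝ} {a x : ℕ → ℝ}

lemma exists_separated (h : IsContactSeq w a x) (hw : IsWeight w) (n : ℕ) :
    ∃ m, Separated a x n m := by
  have h1 : ∀ᶠ m in Filter.atTop, 2 * a n * x m ^ n ≤ w (x m) := by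
    filter_upwards [(h.tendsto_x hw).eventually (hw.eventually_pow_le (n + 1)),
      (h.tendsto_x hw).eventually_ge_atTop (2 * a n)] with m hm hm'
    refine le_trans ?_ hm
    rw [pow_succ']
    exact mul_le_mul_of_nonneg_right hm' (pow_nonneg (h.nonneg m) n)
  have h2 : ∀ᶠ m in Filter.atTop, a m * x n ^ m < w (x n) / 2 :=
    (h.tendsto_term (h.nonneg n)).eventually_lt_const (half_pos (hw.pos _ (h.nonneg n)))
  obtain ⟨m, h1, h2, h3⟩ := (h1.and (h2.and (Filter.eventually_gt_atTop n))).exists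
  refine ⟨m, h3, h1.trans (h.eq m).ge, ?_⟩
  rw [h.eq n]
  linarith

/-- Greedy choice. Minimality is essential: it makes the predecessor of `m (k + 1)` not separated
from `m k`. -/
lemma exists_strictMono_separated (h : IsContactSeq w a x) (hw : IsWeight w) :
    ∃ m : ℕ → ℕ, StrictMono m ∧ m 0 = 0 ∧ ∀ k, Separated a x (m k) (m (k + 1)) ∧
      ∀ p, p < m (k + 1) → ¬ Separated a x (m k) p := by
  classical
  choose nx h1 h2 using fun n => (⟨Nat.find (h.exists_separated hw n),
    Nat.find_spec (h.exists_separated hw n), fun p hp => Nat.find_min _ hp⟩ :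
      ∃ m, Separated a x n m ∧ ∀ p, p < m → ¬ Separated a x n p)
  have hsucc : ∀ k, nx^[k + 1] 0 = nx (nx^[k] 0) := fun k => Function.iterate_succ_apply' nx k 0
  refine ⟨fun k => nx^[k] 0, strictMono_nat_of_lt_succ fun k => ?_, rfl, fun k => ?_⟩
  · rw [hsucc]
    exact (h1 _).1
  · simp only [hsucc]
    exact ⟨h1 _, h2 _⟩

/-- Between the contact points of consecutive selected indices three monomials suffice. -/
lemma norm_le_of_not_separated (h : IsContactSeq w a x) (hw : IsWeight w) {f : ℂ → ℂ}
    (hf : Differentiable ℂ f) (hfw : ∀ r, 0 ≤ r → maxModulus f r ≤ w r) {n p : ℕ} (hnp : n ≤ p)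
    (hsep : ¬ Separated a x n p) {z : ℂ} (h₁ : x n ≤ ‖z‖) (h₂ : ‖z‖ ≤ x (p + 1)) :
    ‖f z‖ ≤ 24 * (a n * ‖z‖ ^ n + a p * ‖z‖ ^ p + a (p + 1) * ‖z‖ ^ (p + 1)) := by
  have hN := h.term_nonneg (norm_nonneg z) n
  have hP := h.term_nonneg (norm_nonneg z) p
  have hQ := h.term_nonneg (norm_nonneg z) (p + 1)
  rcases le_total (x p) ‖z‖ with hz | hz
  · have := h.norm_le_of_mem_Icc hw hf hfw hz h₂
    linarith
  have hxn := h.nonneg n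
  have hx : ∀ {q : ℕ} {y : ℂ}, ‖y‖ = x q → ‖f y‖ ≤ a q * x q ^ q := h.norm_le_of_norm_eq_x hf hfw
  rcases hnp.eq_or_lt with rfl | hnp
  · have := norm_le_mul_pow_of_annulus hf hxn (h.eq_zero_of_x_eq_zero hw) (fun y => hx)
      (fun y => hx) h₁ hz
    linarith
  -- When separation fails, twice one of the two monomials bounds `‖f‖` on both boundary circles.
  simp only [Separated, hnp, true_and, not_and_or, not_le] at hsep
  rcases hsep with hsep | hsep
  · have := norm_le_mul_pow_of_annulus hf (A := 2 * a n) hxn (h.eq_zero_of_x_eq_zero hw)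
      (fun y hy => (hx hy).trans (by linarith [h.term_nonneg hxn n]))
      (fun y hy => (hx hy).trans hsep.le) h₁ hz
    linarith
  · have := norm_le_mul_pow_of_annulus hf (n := p) (A := 2 * a p) hxn
      (fun h0 => by
        rw [h.eq, h0, zero_pow (Nat.ne_of_gt (Nat.zero_lt_of_lt hnp)), mul_zero] at hsep
        exact absurd hsep (hw.pos 0 le_rfl).le.not_gt)
      (fun y hy => (hx hy).trans hsep.le)
      (fun y hy => (hx hy).trans (by linarith [h.term_nonneg (h.nonneg p) p])) h₁ hz
    linarith

lemma term_le_half_pow_of_ge (h : IsContactSeq w a x) (hw : IsWeight w) {m : ℕ → ℕ}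
    (hm : ∀ k, Separated a x (m k) (m (k + 1))) {r : ℝ} (i j : ℕ) (hr : x (m (j + i)) ≤ r) :
    a (m j) * r ^ m j ≤ a (m (j + i)) * r ^ m (j + i) * (1 / 2) ^ i := by
  induction i with
  | zero => simp
  | succ i ih =>
    have hs := hm (j + i)
    have hxp := h.x_pos hw (n := m (j + i + 1)) (by have := hs.1; omega)
    have h1 := ih ((h.monotone_x hw hs.1.le).trans hr)
    have h2 := mul_pow_le_mul_pow_of_le (h.pos _).le hs.1.le hxp hr hs.2.1
    rw [← add_assoc, pow_succ]
    refine h1.trans ?_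
    have h3 : (0 : ℝ) < (1 / 2) ^ i := by positivity
    have := mul_le_mul_of_nonneg_right h2 h3.le
    linarith

lemma term_le_half_pow_of_le (h : IsContactSeq w a x) (hw : IsWeight w) {m : ℕ → ℕ}
    (hm : ∀ k, Separated a x (m k) (m (k + 1))) {r : ℝ} (hr0 : 0 ≤ r) (i j : ℕ)
    (hr : r ≤ x (m j)) :
    a (m (j + i)) * r ^ m (j + i) ≤ a (m j) * r ^ m j * (1 / 2) ^ i := by
  induction i with
  | zero => simp
  | succ i ih =>
    have hmono : Monotone m := monotone_nat_of_le_succ fun k => (hm k).1.le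
    have hs := hm (j + i)
    have h2 := mul_pow_le_mul_pow_of_ge (by linarith [h.pos (m (j + i + 1))]) hs.1.le hr0
      (hr.trans (h.monotone_x hw (hmono (Nat.le_add_right j i)))) hs.2.2
    rw [← add_assoc, pow_succ]
    linarith

/-- The selected monomials and their predecessors have a sum comparable with the weight. -/
lemma summable_and_tsum_le (h : IsContactSeq w a x) (hw : IsWeight w) {m : ℕ → ℕ}
    (hm : ∀ k, Separated a x (m k) (m (k + 1))) {r : ℝ} (hr : 0 ≤ r) {k : ℕ}
    (h₁ : x (m k) ≤ r) (h₂ : r ≤ x (m (k + 1))) :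
    Summable (fun j => a (m j) * r ^ m j + a (m (j + 1) - 1) * r ^ (m (j + 1) - 1)) ∧
      ∑' j, (a (m j) * r ^ m j + a (m (j + 1) - 1) * r ^ (m (j + 1) - 1)) ≤ 16 * w r := by
  have hmono : Monotone m := monotone_nat_of_le_succ fun k => (hm k).1.le
  have hle : ∀ n, a n * r ^ n ≤ w r := fun n => h.le n r hr
  have hwr : 0 < w r := hw.pos r hr
  -- The worst terms are those above `k`: at distance `i + 1` both monomials are at most `w r / 2 ^
  -- i`, hence together `4 * w r / 2 ^ (i + 1)`.
  have key := summable_and_tsum_le_of_geometric (k := k) (c := 4 * w r)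
    (g := fun j => a (m j) * r ^ m j + a (m (j + 1) - 1) * r ^ (m (j + 1) - 1))
    (fun j => add_nonneg (h.term_nonneg hr _) (h.term_nonneg hr _)) ?_ ?_
  · exact ⟨key.1, key.2.trans_eq (by ring)⟩
  · intro i j hij
    rcases i with _ | i
    · simp only [pow_zero, mul_one]
      linarith [hle (m j), hle (m (j + 1) - 1)]
    have hp : (0 : ℝ) < (1 / 2) ^ i := by positivity
    have hrk : x (m (j + 1 + i)) ≤ r := by rwa [show j + 1 + i = k by omega]
    have e1 := h.term_le_half_pow_of_ge hw hm (r := r) (i + 1) j (by rwa [hij])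
    have e2 := h.term_le_half_pow_of_ge hw hm i (j + 1) hrk
    have e3 := h.term_le_of_le hw (show m (j + 1) - 1 ≤ m (j + 1) by omega)
      ((h.monotone_x hw (hmono (Nat.le_add_right (j + 1) i))).trans hrk)
    have e4 := mul_le_mul_of_nonneg_right (hle (m (j + (i + 1)))) hp.le
    have e5 := mul_le_mul_of_nonneg_right (hle (m (j + 1 + i))) hp.le
    have e6 := mul_pos hwr hp
    rw [pow_succ] at e1 ⊢
    linarith
  · intro i
    rcases i with _ | i
    · simp only [pow_zero, mul_one]
      linarith [hle (m (0 + k)), hle (m (0 + k + 1) - 1)]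
    have hp : (0 : ℝ) < (1 / 2) ^ i := by positivity
    have e1 := h.term_le_half_pow_of_le hw hm hr i (k + 1) h₂
    rw [show k + 1 + i = i + 1 + k by omega] at e1
    have e3 := h.term_le_of_ge (n := m (i + 1 + k)) (j := m (i + 1 + k + 1) - 1)
      (by have := (hm (i + 1 + k)).1; omega) hr
      (h₂.trans (h.monotone_x hw (hmono (by omega))))
    have e4 := mul_le_mul_of_nonneg_right (hle (m (k + 1))) hp.le
    rw [pow_succ]
    linarith

lemma exists_mem_Icc (h : IsContactSeq w a x) (hw : IsWeight w) {m : ℕ → ℕ} (hm : StrictMono m)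
    (hm0 : m 0 = 0) {r : ℝ} (hr : 0 ≤ r) : ∃ k, x (m k) ≤ r ∧ r ≤ x (m (k + 1)) := by
  classical
  have hex : ∃ k, r < x (m k) :=
    (((h.tendsto_x hw).comp hm.tendsto_atTop).eventually_gt_atTop r).exists
  have hne : Nat.find hex ≠ 0 := fun h0 => by
    have := Nat.find_spec hex
    rw [h0, hm0, h.zero] at this
    linarith
  obtain ⟨k, hk⟩ := Nat.exists_eq_succ_of_ne_zero hne
  refine ⟨k, not_lt.1 (Nat.find_min hex (by omega)), ?_⟩
  have := Nat.find_spec hex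
  rw [hk] at this
  exact this.le

end IsContactSeq

/-! ### The extremal entire function and the necessity of the integral condition -/

/-- Every weight admits an entire function with nonnegative Taylor coefficients below a multiple of
the weight which is, on `[0, ∞)`, above a multiple of the associated weight. -/
theorem exists_entire_ge_assocWeight {w : ℝ → ℝ} (hw : IsWeight w) :
    ∃ g : ℂ → ℂ, Differentiable ℂ g ∧ (∀ t : ℝ, 0 ≤ t → g t = (‖g t‖ : ℝ)) ∧
      (∀ r, 0 ≤ r → maxModulus g r ≤ 16 * w r) ∧
      ∀ t : ℝ, 0 ≤ t → assocWeight w t ≤ 24 * ‖g t‖ := by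
  obtain ⟨a, x, h⟩ := hw.exists_isContactSeq
  obtain ⟨m, hmono, hm0, hm⟩ := h.exists_strictMono_separated hw
  set F : ℝ → ℕ → ℝ := fun r j => a (m j) * r ^ m j + a (m (j + 1) - 1) * r ^ (m (j + 1) - 1)
    with hF
  set T : ℕ → ℂ → ℂ := fun j z => a (m j) * z ^ m j + a (m (j + 1) - 1) * z ^ (m (j + 1) - 1)
    with hT
  have hsum : ∀ r, 0 ≤ r → Summable (F r) ∧ ∑' j, F r j ≤ 16 * w r := fun r hr => by
    obtain ⟨k, hk1, hk2⟩ := h.exists_mem_Icc hw hmono hm0 hr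
    exact h.summable_and_tsum_le hw (fun k => (hm k).1) hr hk1 hk2
  have hF0 : ∀ r, 0 ≤ r → ∀ j, 0 ≤ F r j := fun r hr j =>
    add_nonneg (h.term_nonneg hr _) (h.term_nonneg hr _)
  have hTF : ∀ j z, ‖T j z‖ ≤ F ‖z‖ j := fun j z => by
    refine (norm_add_le _ _).trans_eq ?_
    simp only [norm_mul, norm_pow, Complex.norm_real, Real.norm_of_nonneg (h.pos _).le, hF]
  have hFm : ∀ j, ∀ r s, 0 ≤ r → r ≤ s → F r j ≤ F s j := fun j r s hr hrs =>
    add_le_add (mul_le_mul_of_nonneg_left (pow_le_pow_left₀ hr hrs _) (h.pos _).le)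
      (mul_le_mul_of_nonneg_left (pow_le_pow_left₀ hr hrs _) (h.pos _).le)
  have hreal : ∀ t : ℝ, 0 ≤ t → ∑' j, T j t = ((∑' j, F t j : ℝ) : ℂ) := fun t ht => by
    rw [Complex.ofReal_tsum]
    exact tsum_congr fun j => by simp [hT, hF]
  have hnorm : ∀ t : ℝ, 0 ≤ t → ‖∑' j, T j t‖ = ∑' j, F t j := fun t ht => by
    rw [hreal t ht, Complex.norm_real, Real.norm_of_nonneg (tsum_nonneg (hF0 t ht))]
  refine ⟨fun z => ∑' j, T j z, fun z => ?_, fun t ht => ?_, fun r hr => ?_, fun t ht => ?_⟩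
  · have hR : 0 ≤ ‖z‖ + 1 := by positivity
    have hd := Complex.differentiableOn_tsum_of_summable_norm (F := T)
      (U := Metric.ball 0 (‖z‖ + 1)) (hsum _ hR).1
      (fun j => by simp only [hT]; fun_prop) Metric.isOpen_ball
      fun j y hy => (hTF j y).trans (hFm j _ _ (norm_nonneg y) ((mem_ball_zero_iff.1 hy).le))
    exact hd.differentiableAt (Metric.isOpen_ball.mem_nhds (by simp))
  · exact (hreal t ht).trans (congrArg _ (hnorm t ht).symm)
  · refine maxModulus_le hr fun z hz => ?_
    refine (tsum_of_norm_bounded (hsum r hr).1.hasSum fun j => ?_).trans (hsum r hr).2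
    rw [← hz]
    exact hTF j z
  · rw [hnorm t ht]
    refine assocWeight_le (fun r hr => (hw.pos r hr).le) fun f hf hfw => ?_
    refine maxModulus_le ht fun z hz => ?_
    obtain ⟨k, hk1, hk2⟩ := h.exists_mem_Icc hw hmono hm0 ht
    have hlt := hmono (Nat.lt_succ_self k)
    have hp : m (k + 1) - 1 + 1 = m (k + 1) := by have : m k < m (k + 1) := hlt; omega
    have h1 := h.norm_le_of_not_separated hw hf hfw (n := m k) (p := m (k + 1) - 1) (z := z)
      (by have : m k < m (k + 1) := hlt; omega) ((hm k).2 _ (by omega))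
      (by rwa [hz]) (by rwa [hz, hp])
    rw [hz, hp] at h1
    -- Term `k` holds the monomials `m k` and `m (k + 1) - 1`; the third one needed, `m (k + 1)`,
    -- sits in term `k + 1`.
    have h2 := (hsum t ht).1.sum_le_tsum {k, k + 1} (fun j _ => hF0 t ht j)
    rw [Finset.sum_pair (Nat.ne_of_lt (Nat.lt_succ_self k))] at h2
    simp only [hF] at h2 ⊢
    have h3 := h.term_nonneg ht (m (k + 1 + 1) - 1)
    linarith

/-- Boundedness of integration implies an integral estimate for the associated weight. -/
theorem exists_integral_assocWeight_le {w u : ℝ → ℝ} (hw : IsWeight w)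
    (hu : ∀ r, 0 ≤ r → 0 < u r) (hJ : IsBoundedOperator integrationOp w u) :
    ∃ C : ℝ, ∀ r : ℝ, 0 ≤ r → (∫ t in (0 : ℝ)..r, assocWeight w t) ≤ C * u r := by
  obtain ⟨g, hg, hgreal, hgw, hgW⟩ := exists_entire_ge_assocWeight hw
  have hgmem : g ∈ growthSpace w :=
    ⟨hg, (growthNorm_le_ofReal hw.pos hgw).trans_lt ENNReal.ofReal_lt_top⟩
  have hJg := hJ.1 hgmem
  refine ⟨24 * (growthNorm u (integrationOp g)).toReal, fun r hr => ?_⟩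
  have hcont : Continuous fun t : ℝ => ‖g t‖ := (hg.continuous.comp (by fun_prop)).norm
  have hint : ∫ t in (0 : ℝ)..r, ‖g t‖ ≤ (growthNorm u (integrationOp g)).toReal * u r := by
    refine le_trans ?_ (maxModulus_le_growthNorm_mul hu hJg.2.ne hr)
    have h1 := norm_le_maxModulus hJg.1.continuous r
    rw [integrationOp_ofReal hr hgreal, Complex.norm_real, Complex.norm_real,
      Real.norm_of_nonneg hr] at h1
    exact (le_abs_self _).trans h1
  calc ∫ t in (0 : ℝ)..r, assocWeight w t ≤ ∫ t in (0 : ℝ)..r, 24 * ‖g t‖ :=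
        intervalIntegral.integral_mono_on hr
          (intervalIntegrable_assocWeight (fun r hr => (hw.pos r hr).le) hr)
          ((hcont.const_mul 24).intervalIntegrable _ _) fun t ht => hgW t ht.1
    _ = 24 * ∫ t in (0 : ℝ)..r, ‖g t‖ := intervalIntegral.integral_const_mul _ _
    _ ≤ _ := by linarith

end GrowthSpace

theorem mainTheorem2 (w u : ℝ → ℝ) (hw : GrowthSpace.IsWeight w) (hu : GrowthSpace.IsWeight u) :
    (∃ C : ℝ, ∀ r : ℝ, 0 ≤ r → (∫ t in (0 : ℝ)..r, GrowthSpace.assocWeight w t) ≤ C * u r) ↔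
      GrowthSpace.IsBoundedOperator GrowthSpace.integrationOp w u :=
  ⟨fun ⟨_, hC⟩ => GrowthSpace.isBoundedOperator_of_integral_assocWeight_le hw.pos hu.pos hC,
    GrowthSpace.exists_integral_assocWeight_le hw hu.pos⟩
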